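/- Let $F$ be any field and $d\ge 2$ an integer. A matrix $H\in F^{2d\times 2d}$ is called symplectic if $H^TJH=J$, where $J=\begin{bmatrix}0&I\\-I&0\end{bmatrix}$ (blocks of size $d\times d$); let $\mathcal{SP}=Sp(d,F)$ be the group of symplectic matrices. Let $\mathcal T$ be the set of all matrices $\begin{bmatrix}I&S\\0&I\end{bmatrix}$ and $\begin{bmatrix}I&0\\S&I\end{bmatrix}$ with $S\in F^{d\times d}$, $S^T=S$, and for $n\ge 0$ let $\mathcal L_n=\{H_n\cdots H_2H_1 : H_1,\dots,H_n\in\mathcal T\}$ (with $\mathcal L_0=\{I\}$). (1) For every $H\in\mathcal{SP}$ there exist $\delta_1,\dots,\delta_d\in\{0,1\}\subset F$ and symmetric $S,T,U,V\in F^{d\times d}$ such that $$H=\begin{bmatrix}I&\operatorname{diag}(\delta_1,\dots,\delta_d)\\0&I\end{bmatrix}\begin{bmatrix}I&0\\S&I\end{bmatrix}\begin{bmatrix}I&T\\0&I\end{bmatrix}\begin{bmatrix}I&0\\U&I\end{bmatrix}\begin{bmatrix}I&V\\0&I\end{bmatrix}.$$ (2) $\mathcal L_4\subsetneq\mathcal{SP}=\mathcal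 L_5$. (3) For every nonsingular, non-symmetric $Q\in F^{d\times d}$, the matrix $\begin{bmatrix}0&Q\\-Q^{-T}&0\end{bmatrix}$ (where $Q^{-T}=(Q^T)^{-1}$) lies in $\mathcal{SP}$ but not in $\mathcal L_4$. (4) Five factors is optimal: $5$ is the smallest integer $n\ge 0$ with $\mathcal L_n=\mathcal{SP}$. -/

import Mathlib

open Matrix

namespace SympFactor

/-- The unit triangular symplectic matrices: `[[I, S], [0, I]]` and `[[I, 0], [S, I]]`
with `S` symmetric. -/
def unitTriangular (d : ℕ) (F : Type*) [Field F] :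
    Set (Matrix (Fin d ⊕ Fin d) (Fin d ⊕ Fin d) F) :=
  {H | ∃ S : Matrix (Fin d) (Fin d) F, S.IsSymm ∧
    (H = fromBlocks 1 S 0 1 ∨ H = fromBlocks 1 0 S 1)}

/-- The set of all products `Hₙ ⋯ H₂ H₁` of exactly `n` unit triangular symplectic matrices
(upper and lower ones in any order). -/
def unitTriangularProducts (d : ℕ) (F : Type*) [Field F] (n : ℕ) :
    Set (Matrix (Fin d ⊕ Fin d) (Fin d ⊕ Fin d) F) :=
  {H | ∃ l : List (Matrix (Fin d ⊕ Fin d) (Fin d ⊕ Fin d) F),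
    l.length = n ∧ (∀ M ∈ l, M ∈ unitTriangular d F) ∧ H = l.prod}

/-- Mathlib's symplectic group, `H J Hᵀ = J` for `J = [[0, -I], [I, 0]]`, is the set of
matrices with `Hᵀ J H = J` for `J = [[0, I], [-I, 0]]`. -/
theorem mem_symplecticGroup_iff_transpose_mul (d : ℕ) (F : Type*) [Field F]
    (H : Matrix (Fin d ⊕ Fin d) (Fin d ⊕ Fin d) F) :
    H ∈ symplecticGroup (Fin d) F ↔
      Hᵀ * fromBlocks 0 1 (-1) 0 * H = fromBlocks 0 1 (-1) 0 := by
  have hJ : (fromBlocks 0 1 (-1) 0 : Matrix (Fin d ⊕ Fin d) (Fin d ⊕ Fin d) F)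
      = -J (Fin d) F := by
    rw [J, fromBlocks_neg]; simp
  rw [hJ, SymplecticGroup.mem_iff']
  simp

end SympFactor

/-!
Over a field every square matrix is a product `T * U` of two symmetric matrices: an endomorphism
`f` of a finite-dimensional space is self-adjoint for some nondegenerate symmetric form. Indeed `f`
makes the space a direct sum of `F[X]`-modules `F[X] / (p ^ e)`, and `(u, v) ↦ l (u * v)` is such a
form on `F[X] / (p ^ e)` for any functional `l` not vanishing on its smallest nonzero ideal.

A symplectic matrix with invertible upper left block `A` is determined by `A` up to a lower unit
triangular factor on the left and an upper one on the right. Writing `A - 1 = T * U`, the product of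
`[[1, T], [0, 1]]` and `[[1, 0], [U, 1]]` also has upper left block `A`, which gives four factors.
A fifth factor, with a diagonal block `δ`, replaces `A` by `A - δ * C`. Taking `δ` with minimal
kernel makes this invertible: symmetry of `Aᵀ * C` forces the kernel to shrink when a coordinate
`δ i` is changed for which the kernel contains some `v` with `(C *ᵥ v) i ≠ 0`.

For the lower bound, a product of four factors may be taken alternating, and then a zero diagonal
block (the lower right one if the first factor is upper, the upper left one otherwise) forces an
off-diagonal block to be symmetric.
-/

namespace SympFactor

section SymmetricFactorization

variable {F R M : Type*} [Field F] [CommRing R] [IsDomain R] [IsPrincipalIdealRing R]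

theorem dvd_mk_pow_of_ne_zero {p : R} (hp : Irreducible p) {e : ℕ}
    {u : R ⧸ Ideal.span {p ^ (e + 1)}} (hu : u ≠ 0) : u ∣ Ideal.Quotient.mk _ (p ^ e) := by
  obtain ⟨g, rfl⟩ := Ideal.Quotient.mk_surjective u
  rw [Ne, Ideal.Quotient.eq_zero_iff_mem, Ideal.mem_span_singleton] at hu
  obtain ⟨k, hk, hgcd⟩ :=
    (dvd_prime_pow hp.prime (e + 1)).1 (IsBezout.gcd_dvd_right g (p ^ (e + 1)))
  have hke : k ≤ e := by
    refine Nat.le_of_lt_succ (hk.lt_of_ne ?_)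
    rintro rfl
    exact hu (hgcd.symm.dvd.trans (IsBezout.gcd_dvd_left _ _))
  obtain ⟨a, b, hab⟩ := IsBezout.gcd_eq_sum g (p ^ (e + 1))
  obtain ⟨c, hc⟩ := hgcd.dvd.trans (pow_dvd_pow p hke)
  refine ⟨Ideal.Quotient.mk _ (a * c), ?_⟩
  rw [← map_mul, Ideal.Quotient.eq, Ideal.mem_span_singleton]
  exact ⟨b * c, by rw [hc, ← hab]; ring⟩

theorem exists_dual_forall_mul_eq_zero_imp [Algebra F R] {p : R} (hp : Irreducible p) (e : ℕ) :
    ∃ l : Module.Dual F (R ⧸ Ideal.span {p ^ e}), ∀ u, (∀ w, l (u * w) = 0) → u = 0 := by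
  rcases e with _ | e
  · have : Subsingleton (R ⧸ Ideal.span {p ^ 0}) := by
      simp
    exact ⟨0, fun u _ => Subsingleton.elim u 0⟩
  -- The class of `p ^ e` lies in every nonzero ideal, so `l` only has to be nonzero there.
  have hpe : Ideal.Quotient.mk (Ideal.span {p ^ (e + 1)}) (p ^ e) ≠ 0 := by
    rw [Ne, Ideal.Quotient.eq_zero_iff_mem, Ideal.mem_span_singleton,
      pow_dvd_pow_iff hp.ne_zero hp.not_isUnit]
    exact Nat.not_succ_le_self e
  obtain ⟨l, hl⟩ := Module.Projective.exists_dual_ne_zero F hpe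
  refine ⟨l, fun u hu => by_contra fun hu0 => hl ?_⟩
  obtain ⟨w, hw⟩ := dvd_mk_pow_of_ne_zero hp hu0
  rw [hw, hu]

theorem exists_isSymm_nondegenerate_forall_isSelfAdjoint_smul [Algebra F R] [AddCommGroup M]
    [Module F M] [Module R M] [IsScalarTower F R M] [Module.Finite R M]
    (hM : Module.IsTorsion R M) :
    ∃ B : LinearMap.BilinForm F M, B.IsSymm ∧ B.Nondegenerate ∧
      ∀ r : R, B.IsSelfAdjoint (r • ·) := by
  classical
  obtain ⟨ι, _, p, hp, e, ⟨E⟩⟩ := Module.equiv_directSum_of_isTorsion hM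
  choose l hl using fun i => exists_dual_forall_mul_eq_zero_imp (F := F) (hp i) (e i)
  let φ := E.trans (DirectSum.linearEquivFunOnFintype R ι _)
  let φF (i : ι) : M →ₗ[F] R ⧸ Ideal.span {p i ^ e i} :=
    (LinearMap.proj i ∘ₗ φ.toLinearMap).restrictScalars F
  let B : LinearMap.BilinForm F M :=
    ∑ i, ((LinearMap.mul F (R ⧸ Ideal.span {p i ^ e i})).compl₁₂ (φF i) (φF i)).compr₂ (l i)
  have hB (x y : M) : B x y = ∑ i, l i (φ x i * φ y i) := by
    simp [B, φF, LinearMap.sum_apply]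
  have hsymm : B.IsSymm := ⟨fun x y => by simp only [hB, mul_comm]⟩
  refine ⟨B, hsymm, ?_, fun r x y => by simp [hB]⟩
  refine (LinearMap.IsRefl.nondegenerate_iff_separatingLeft hsymm.isRefl).2 fun x hx => ?_
  refine φ.map_eq_zero_iff.1 (funext fun i => hl i _ fun w => ?_)
  obtain ⟨y, hy⟩ := φ.surjective (Pi.single i w)
  have hxy := hx y
  rw [hB, hy, Finset.sum_eq_single i (fun j _ hj => by simp [hj]) (by simp)] at hxy
  simpa using hxy

open Polynomial in
theorem exists_isSymm_nondegenerate_isSelfAdjoint [AddCommGroup M] [Module F M]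
    [FiniteDimensional F M] (f : Module.End F M) :
    ∃ B : LinearMap.BilinForm F M, B.IsSymm ∧ B.Nondegenerate ∧ B.IsSelfAdjoint f := by
  obtain ⟨B, hsymm, hB, hadj⟩ := exists_isSymm_nondegenerate_forall_isSelfAdjoint_smul (F := F)
    (Module.AEval.isTorsion_of_finiteDimensional F M f)
  let e := (Module.AEval'.of f).symm
  refine ⟨LinearMap.BilinForm.congr e B, ⟨fun x y => hsymm.eq _ _⟩,
    (LinearMap.BilinForm.nondegenerate_congr_iff e).2 hB, fun x y => ?_⟩
  have h := hadj X (e.symm x) (e.symm y)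
  simpa [e, Module.AEval'.X_smul_of] using h

theorem exists_isSymm_mul_isSymm_eq {n : Type*} [Fintype n] (A : Matrix n n F) :
    ∃ S T : Matrix n n F, S.IsSymm ∧ T.IsSymm ∧ S * T = A := by
  classical
  obtain ⟨B, hsymm, hB, hadj⟩ := exists_isSymm_nondegenerate_isSelfAdjoint (toLin' A)
  obtain ⟨P, rfl⟩ := toBilin'.surjective B
  have hP : P.IsSymm := isSymm_toBilin'_iff_isSymm.1 hsymm
  have hPA : Aᵀ * P = P * A := (isAdjointPair_toLinearMap₂' P P A A).1 hadj
  have hdet : IsUnit P.det :=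
    (LinearMap.BilinForm.nondegenerate_toBilin'_iff_det_ne_zero.1 hB).isUnit
  refine ⟨P⁻¹, P * A, hP.inv, ?_, nonsing_inv_mul_cancel_left _ _ hdet⟩
  rw [IsSymm, transpose_mul, hP.eq, hPA]

end SymmetricFactorization

section DiagonalShift

variable {n R : Type*} [Fintype n] [CommRing R]

theorem sub_dotProduct_mulVec_mul_mulVec_eq_zero {A C : Matrix n n R} (hAC : Aᵀ * C = Cᵀ * A)
    {δ ε v w : n → R} (hv : A *ᵥ v = δ * (C *ᵥ v)) (hw : A *ᵥ w = ε * (C *ᵥ w)) :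
    (δ - ε) ⬝ᵥ ((C *ᵥ v) * (C *ᵥ w)) = 0 := by
  have hpair : (A *ᵥ v) ⬝ᵥ (C *ᵥ w) = (C *ᵥ v) ⬝ᵥ (A *ᵥ w) := by
    rw [← vecMul_transpose A v, ← vecMul_transpose C v, ← dotProduct_mulVec,
      ← dotProduct_mulVec, mulVec_mulVec, mulVec_mulVec, hAC]
  rw [hv, hw, ← sub_eq_zero] at hpair
  rw [← hpair]
  simp only [dotProduct, ← Finset.sum_sub_distrib, Pi.sub_apply, Pi.mul_apply]
  exact Finset.sum_congr rfl fun j _ => by ring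

variable [DecidableEq n]

theorem mem_ker_sub_diagonal_mul_iff {A C : Matrix n n R} {δ v : n → R} :
    v ∈ (A - diagonal δ * C).mulVecLin.ker ↔ A *ᵥ v = δ * (C *ᵥ v) := by
  rw [LinearMap.mem_ker, mulVecLin_apply, sub_mulVec, sub_eq_zero, ← mulVec_mulVec,
    funext_iff, funext_iff]
  simp only [mulVec_diagonal, Pi.mul_apply]

theorem ker_sub_diagonal_update_mul_lt [IsDomain R] {A C : Matrix n n R} (hAC : Aᵀ * C = Cᵀ * A)
    {δ v : n → R} (hv : A *ᵥ v = δ * (C *ᵥ v)) {i : n} (hi : (C *ᵥ v) i ≠ 0) {a : R}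
    (ha : a ≠ δ i) :
    (A - diagonal (Function.update δ i a) * C).mulVecLin.ker <
      (A - diagonal δ * C).mulVecLin.ker := by
  refine SetLike.lt_iff_le_and_exists.2 ⟨fun w hw => ?_, v, mem_ker_sub_diagonal_mul_iff.2 hv,
    fun hv' => ha ?_⟩
  · rw [mem_ker_sub_diagonal_mul_iff] at hw ⊢
    have hsupp : δ - Function.update δ i a = Pi.single i (δ i - a) := by
      ext j
      rcases eq_or_ne j i with rfl | hj <;> simp [*]
    have h := sub_dotProduct_mulVec_mul_mulVec_eq_zero hAC hv hw
    have hwi : (C *ᵥ w) i = 0 := by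
      simpa [hsupp, single_dotProduct, sub_eq_zero, ha.symm, hi] using h
    rw [hw]
    ext j
    rcases eq_or_ne j i with rfl | hj <;> simp [*]
  · rw [mem_ker_sub_diagonal_mul_iff, hv] at hv'
    simpa [hi] using (congrFun hv' i).symm

theorem exists_isUnit_sub_diagonal_mul {F : Type*} [Field F] {A C : Matrix n n F}
    (hAC : Aᵀ * C = Cᵀ * A) (hker : ∀ v, A *ᵥ v = 0 → C *ᵥ v = 0 → v = 0) {s : n → Set F}
    (hs : ∀ i, (s i).Nontrivial) :
    ∃ δ : n → F, (∀ i, δ i ∈ s i) ∧ IsUnit (A - diagonal δ * C) := by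
  obtain ⟨δ, hδ, hmin⟩ := exists_minimalFor_of_wellFoundedLT (fun δ : n → F => ∀ i, δ i ∈ s i)
    (fun δ => (A - diagonal δ * C).mulVecLin.ker)
    ⟨fun i => (hs i).nonempty.some, fun i => (hs i).nonempty.some_mem⟩
  suffices hbot : (A - diagonal δ * C).mulVecLin.ker = ⊥ from
    ⟨δ, hδ, mulVec_injective_iff_isUnit.1 (LinearMap.ker_eq_bot.1 hbot)⟩
  refine (Submodule.eq_bot_iff _).2 fun v hv => ?_
  rw [mem_ker_sub_diagonal_mul_iff] at hv
  suffices hCv : C *ᵥ v = 0 from hker v (by rw [hv, hCv, mul_zero]) hCv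
  ext i
  by_contra hi
  obtain ⟨a, has, ha⟩ := (hs i).exists_ne (δ i)
  have hlt := ker_sub_diagonal_update_mul_lt hAC hv hi ha
  refine hlt.not_ge (hmin (fun j => ?_) hlt.le)
  rcases eq_or_ne j i with rfl | hj <;> simp [*]

end DiagonalShift

section Symplectic

variable {n R : Type*} [Fintype n] [DecidableEq n] [CommRing R]

theorem fromBlocks_upper_mul_upper (S T : Matrix n n R) :
    (fromBlocks 1 S 0 1 : Matrix (n ⊕ n) (n ⊕ n) R) * fromBlocks 1 T 0 1 =
      fromBlocks 1 (S + T) 0 1 := by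
  simp [fromBlocks_multiply, add_comm]

theorem fromBlocks_lower_mul_lower (S T : Matrix n n R) :
    (fromBlocks 1 0 S 1 : Matrix (n ⊕ n) (n ⊕ n) R) * fromBlocks 1 0 T 1 =
      fromBlocks 1 0 (S + T) 1 := by
  simp [fromBlocks_multiply]

variable (n R) in
/-- The upper unit triangular symplectic matrices `[[I, S], [0, I]]`, closed under products because
multiplying two of them adds the blocks `S`. -/
def upperUnitTriangular : Submonoid (Matrix (n ⊕ n) (n ⊕ n) R) where
  carrier := {H | ∃ S : Matrix n n R, S.IsSymm ∧ fromBlocks 1 S 0 1 = H}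
  one_mem' := ⟨0, isSymm_zero, fromBlocks_one⟩
  mul_mem' := by
    rintro _ _ ⟨S, hS, rfl⟩ ⟨T, hT, rfl⟩
    exact ⟨S + T, hS.add hT, (fromBlocks_upper_mul_upper S T).symm⟩

variable (n R) in
/-- The lower unit triangular symplectic matrices `[[I, 0], [S, I]]`. -/
def lowerUnitTriangular : Submonoid (Matrix (n ⊕ n) (n ⊕ n) R) where
  carrier := {H | ∃ S : Matrix n n R, S.IsSymm ∧ fromBlocks 1 0 S 1 = H}
  one_mem' := ⟨0, isSymm_zero, fromBlocks_one⟩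
  mul_mem' := by
    rintro _ _ ⟨S, hS, rfl⟩ ⟨T, hT, rfl⟩
    exact ⟨S + T, hS.add hT, (fromBlocks_lower_mul_lower S T).symm⟩

theorem upperUnitTriangular_le_symplecticGroup :
    upperUnitTriangular n R ≤ symplecticGroup n R := by
  rintro _ ⟨S, hS, rfl⟩
  simp [SymplecticGroup.fromBlocks_mem_iff, hS.eq]

theorem lowerUnitTriangular_le_symplecticGroup :
    lowerUnitTriangular n R ≤ symplecticGroup n R := by
  rintro _ ⟨S, hS, rfl⟩
  simp [SymplecticGroup.fromBlocks_mem_iff, hS.eq]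

theorem isSymm_mul_inv_of_transpose_mul_eq {A C : Matrix n n R} (hA : IsUnit A)
    (hAC : Aᵀ * C = Cᵀ * A) : (C * A⁻¹).IsSymm := by
  have hdet := (isUnit_iff_isUnit_det A).1 hA
  calc (C * A⁻¹)ᵀ = Aᵀ⁻¹ * (Cᵀ * A) * A⁻¹ := by
        rw [transpose_mul, transpose_nonsing_inv, ← Matrix.mul_assoc,
          mul_nonsing_inv_cancel_right _ _ hdet]
    _ = C * A⁻¹ := by
        rw [← hAC, nonsing_inv_mul_cancel_left _ _ (isUnit_det_transpose A hdet)]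

theorem exists_eq_lower_mul_diagonal_mul_upper {A B C D : Matrix n n R}
    (h : fromBlocks A B C D ∈ symplecticGroup n R) (hA : IsUnit A) :
    ∃ X Y : Matrix n n R, X.IsSymm ∧ Y.IsSymm ∧
      fromBlocks A B C D = fromBlocks 1 0 X 1 * fromBlocks A 0 0 Aᵀ⁻¹ * fromBlocks 1 Y 0 1 := by
  have hdet := (isUnit_iff_isUnit_det A).1 hA
  obtain ⟨hAC, -, hAD⟩ := SymplecticGroup.fromBlocks_mem_iff.1 h
  have hBA : Aᵀᵀ * Bᵀ = Bᵀᵀ * Aᵀ := by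
    have hT := SymplecticGroup.transpose_mem h
    rw [fromBlocks_transpose] at hT
    exact (SymplecticGroup.fromBlocks_mem_iff.1 hT).1
  have hY : (A⁻¹ * B).IsSymm := by
    have h := isSymm_mul_inv_of_transpose_mul_eq ((isUnit_transpose A).2 hA) hBA
    simpa [transpose_nonsing_inv] using h.transpose
  have hSchur : D - C * A⁻¹ * B = Aᵀ⁻¹ := by
    refine (inv_eq_right_inv ?_).symm
    rw [Matrix.mul_sub, Matrix.mul_assoc, ← Matrix.mul_assoc, hAC, Matrix.mul_assoc,
      mul_nonsing_inv_cancel_left _ _ hdet, hAD]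
  refine ⟨C * A⁻¹, A⁻¹ * B, isSymm_mul_inv_of_transpose_mul_eq hA hAC, hY, ?_⟩
  let := hA.invertible
  rw [← hSchur, ← invOf_eq_nonsing_inv]
  exact fromBlocks_eq_of_invertible₁₁ A B C D

theorem exists_eq_lower_mul_mul_upper {A B C D B' C' D' : Matrix n n R}
    (h : fromBlocks A B C D ∈ symplecticGroup n R)
    (h' : fromBlocks A B' C' D' ∈ symplecticGroup n R) (hA : IsUnit A) :
    ∃ X Y : Matrix n n R, X.IsSymm ∧ Y.IsSymm ∧
      fromBlocks A B C D =
        fromBlocks 1 0 X 1 * fromBlocks A B' C' D' * fromBlocks 1 Y 0 1 := by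
  obtain ⟨X, Y, hX, hY, hXY⟩ := exists_eq_lower_mul_diagonal_mul_upper h hA
  obtain ⟨X', Y', hX', hY', hXY'⟩ := exists_eq_lower_mul_diagonal_mul_upper h' hA
  refine ⟨X - X', Y - Y', hX.sub hX', hY.sub hY', ?_⟩
  calc fromBlocks A B C D
      = fromBlocks 1 0 (X - X' + X') 1 * fromBlocks A 0 0 Aᵀ⁻¹ *
          fromBlocks 1 (Y' + (Y - Y')) 0 1 := by
        rw [sub_add_cancel, add_sub_cancel, hXY]
    _ = fromBlocks 1 0 (X - X') 1 * fromBlocks A B' C' D' * fromBlocks 1 (Y - Y') 0 1 := by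
        simp only [hXY', ← fromBlocks_lower_mul_lower, ← fromBlocks_upper_mul_upper,
          Matrix.mul_assoc]

theorem eq_zero_of_mulVec_eq_zero_of_mem_symplecticGroup {A B C D : Matrix n n R}
    (h : fromBlocks A B C D ∈ symplecticGroup n R) {v : n → R} (hA : A *ᵥ v = 0)
    (hC : C *ᵥ v = 0) : v = 0 := by
  have hAD := congrArg (·ᵀ *ᵥ v) (SymplecticGroup.fromBlocks_mem_iff.1 h).2.2
  simpa [sub_mulVec, ← mulVec_mulVec, hA, hC, eq_comm] using hAD

variable {F : Type*} [Field F]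

theorem exists_eq_four_of_isUnit {A B C D : Matrix n n F}
    (h : fromBlocks A B C D ∈ symplecticGroup n F) (hA : IsUnit A) :
    ∃ S T U V : Matrix n n F, S.IsSymm ∧ T.IsSymm ∧ U.IsSymm ∧ V.IsSymm ∧
      fromBlocks A B C D = fromBlocks 1 0 S 1 * fromBlocks 1 T 0 1 * fromBlocks 1 0 U 1 *
        fromBlocks 1 V 0 1 := by
  obtain ⟨T, U, hT, hU, hTU⟩ := exists_isSymm_mul_isSymm_eq (A - 1)
  have hmul : fromBlocks 1 T 0 1 * fromBlocks 1 0 U 1 = fromBlocks A T U 1 := by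
    simp [fromBlocks_multiply, hTU]
  have hmem : fromBlocks A T U 1 ∈ symplecticGroup n F :=
    hmul ▸ mul_mem (upperUnitTriangular_le_symplecticGroup ⟨T, hT, rfl⟩)
      (lowerUnitTriangular_le_symplecticGroup ⟨U, hU, rfl⟩)
  obtain ⟨S, V, hS, hV, hSV⟩ := exists_eq_lower_mul_mul_upper h hmem hA
  exact ⟨S, T, U, V, hS, hT, hU, hV, by rw [hSV, ← hmul, ← Matrix.mul_assoc]⟩

theorem exists_eq_diagonal_mul_four {H : Matrix (n ⊕ n) (n ⊕ n) F}
    (hH : H ∈ symplecticGroup n F) {s : n → Set F} (hs : ∀ i, (s i).Nontrivial) :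
    ∃ δ : n → F, (∀ i, δ i ∈ s i) ∧
      ∃ S T U V : Matrix n n F, S.IsSymm ∧ T.IsSymm ∧ U.IsSymm ∧ V.IsSymm ∧
        H = fromBlocks 1 (diagonal δ) 0 1 * fromBlocks 1 0 S 1 * fromBlocks 1 T 0 1 *
          fromBlocks 1 0 U 1 * fromBlocks 1 V 0 1 := by
  obtain ⟨A, B, C, D, rfl⟩ : ∃ A B C D, H = fromBlocks A B C D :=
    ⟨_, _, _, _, (fromBlocks_toBlocks H).symm⟩
  obtain ⟨δ, hδ, hunit⟩ := exists_isUnit_sub_diagonal_mul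
    (SymplecticGroup.fromBlocks_mem_iff.1 hH).1
    (fun _ => eq_zero_of_mulVec_eq_zero_of_mem_symplecticGroup hH) hs
  have hmul : fromBlocks 1 (-diagonal δ) 0 1 * fromBlocks A B C D =
      fromBlocks (A - diagonal δ * C) (B - diagonal δ * D) C D := by
    simp [-diagonal_neg, fromBlocks_multiply, sub_eq_add_neg]
  obtain ⟨S, T, U, V, hS, hT, hU, hV, h⟩ := exists_eq_four_of_isUnit
    (hmul ▸ mul_mem (upperUnitTriangular_le_symplecticGroup
      ⟨_, (isSymm_diagonal δ).neg, rfl⟩) hH) hunit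
  refine ⟨δ, hδ, S, T, U, V, hS, hT, hU, hV, ?_⟩
  calc fromBlocks A B C D
      = fromBlocks 1 (diagonal δ) 0 1 *
          (fromBlocks 1 (-diagonal δ) 0 1 * fromBlocks A B C D) := by
        rw [← Matrix.mul_assoc, fromBlocks_upper_mul_upper, add_neg_cancel, fromBlocks_one,
          Matrix.one_mul]
    _ = _ := by simp only [hmul, h, Matrix.mul_assoc]

end Symplectic

section AlternatingProducts

open scoped Pointwise

variable {M : Type*} [Monoid M]

theorem setOf_list_prod_eq_pow (s : Set M) (n : ℕ) :
    {x | ∃ l : List M, l.length = n ∧ (∀ y ∈ l, y ∈ s) ∧ x = l.prod} = s ^ n := by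
  induction n with
  | zero => ext; simp
  | succ n ih =>
    rw [pow_succ', ← ih]
    ext x
    refine ⟨?_, ?_⟩
    · rintro ⟨_ | ⟨y, l⟩, hlen, hl, rfl⟩
      · simp at hlen
      · rw [List.forall_mem_cons] at hl
        exact Set.mul_mem_mul hl.1 ⟨l, by simpa using hlen, hl.2, rfl⟩
    · rintro ⟨y, hy, _, ⟨l, rfl, hl, rfl⟩, rfl⟩
      exact ⟨y :: l, rfl, List.forall_mem_cons.2 ⟨hy, hl⟩, rfl⟩

/-- The products of `n` factors taken alternately from `U` and `L`, the leftmost one from `U`.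
Passing to the next factor is encoded by swapping the two arguments. -/
def alternatingProducts (U L : Submonoid M) : ℕ → Set M
  | 0 => 1
  | n + 1 => U * alternatingProducts L U n

theorem alternatingProducts_subset_succ (U L : Submonoid M) (n : ℕ) :
    alternatingProducts U L n ⊆ alternatingProducts U L (n + 1) := by
  induction n generalizing U L with
  | zero => simp [alternatingProducts]
  | succ n ih => exact Set.mul_subset_mul_left (ih L U)

theorem mul_alternatingProducts_subset (U L : Submonoid M) (n : ℕ) :
    U * alternatingProducts U L n ⊆ alternatingProducts U L (n + 1) := by
  rcases n with _ | n
  · rfl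
  · calc (U : Set M) * (U * alternatingProducts L U n)
        = alternatingProducts U L (n + 1) := by
          rw [← mul_assoc, Submonoid.coe_mul_self_eq, alternatingProducts]
      _ ⊆ alternatingProducts U L (n + 1 + 1) := alternatingProducts_subset_succ U L (n + 1)

theorem union_pow_subset_alternatingProducts (U L : Submonoid M) (n : ℕ) :
    (U ∪ L : Set M) ^ n ⊆ alternatingProducts U L n ∪ alternatingProducts L U n := by
  induction n with
  | zero => simp [alternatingProducts]
  | succ n ih =>
    calc (U ∪ L : Set M) ^ (n + 1)
        ⊆ (U ∪ L : Set M) * (alternatingProducts U L n ∪ alternatingProducts L U n) := by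
          rw [pow_succ']
          exact Set.mul_subset_mul_left ih
      _ ⊆ alternatingProducts U L (n + 1) ∪ alternatingProducts L U (n + 1) := by
          rw [Set.union_mul, Set.mul_union, Set.mul_union]
          exact Set.union_subset_union
            (Set.union_subset (mul_alternatingProducts_subset U L n) subset_rfl)
            (Set.union_subset subset_rfl (mul_alternatingProducts_subset L U n))

end AlternatingProducts

section Products

open scoped Pointwise

variable {n R : Type*} [Fintype n] [DecidableEq n] [CommRing R]

variable (n R) in
/-- The symplectic matrices that are upper or lower unit triangular, over any commutative ring and
any index type; `unitTriangular d F` is the case of `Fin d` and a field `F`. -/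
def triangularFactors : Set (Matrix (n ⊕ n) (n ⊕ n) R) :=
  upperUnitTriangular n R ∪ lowerUnitTriangular n R

theorem one_mem_triangularFactors : 1 ∈ triangularFactors n R :=
  Or.inl (one_mem _)

theorem triangularFactors_pow_subset_symplecticGroup (k : ℕ) :
    triangularFactors n R ^ k ⊆ symplecticGroup n R :=
  Submonoid.pow_subset (Set.union_subset upperUnitTriangular_le_symplecticGroup
    lowerUnitTriangular_le_symplecticGroup)

theorem symplecticGroup_eq_triangularFactors_pow_five {F : Type*} [Field F] :
    (symplecticGroup n F : Set (Matrix (n ⊕ n) (n ⊕ n) F)) = triangularFactors n F ^ 5 := by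
  refine subset_antisymm (fun H hH => ?_) (triangularFactors_pow_subset_symplecticGroup 5)
  obtain ⟨δ, -, S, T, U, V, hS, hT, hU, hV, rfl⟩ :=
    exists_eq_diagonal_mul_four hH (s := fun _ => Set.univ) fun _ => Set.nontrivial_univ
  simp only [pow_succ, pow_zero, one_mul]
  exact Set.mul_mem_mul (Set.mul_mem_mul (Set.mul_mem_mul (Set.mul_mem_mul
    (Or.inl ⟨_, isSymm_diagonal δ, rfl⟩) (Or.inr ⟨S, hS, rfl⟩)) (Or.inl ⟨T, hT, rfl⟩))
    (Or.inr ⟨U, hU, rfl⟩)) (Or.inl ⟨V, hV, rfl⟩)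

theorem isSymm_of_mem_alternatingProducts_upper_lower {A B C : Matrix n n R}
    (h : fromBlocks A B C 0 ∈
      alternatingProducts (upperUnitTriangular n R) (lowerUnitTriangular n R) 4) : C.IsSymm := by
  obtain ⟨_, ⟨S, -, rfl⟩, _, ⟨_, ⟨T, hT, rfl⟩, _, ⟨_, ⟨V, -, rfl⟩, _,
    ⟨_, ⟨W, -, rfl⟩, _, rfl, rfl⟩, rfl⟩, rfl⟩, h⟩ := h
  simp only [fromBlocks_multiply, fromBlocks_inj, mul_one, one_mul, mul_zero, zero_mul,
    add_zero, zero_add] at h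
  obtain ⟨-, -, hC, hD⟩ := h
  have hCT : C = T + (T * V + 1) * W := by rw [← hC]; noncomm_ring
  rwa [hCT, hD, zero_mul, add_zero]

theorem isSymm_of_mem_alternatingProducts_lower_upper {B C D : Matrix n n R}
    (h : fromBlocks 0 B C D ∈
      alternatingProducts (lowerUnitTriangular n R) (upperUnitTriangular n R) 4) : B.IsSymm := by
  obtain ⟨_, ⟨S, -, rfl⟩, _, ⟨_, ⟨T, hT, rfl⟩, _, ⟨_, ⟨V, -, rfl⟩, _,
    ⟨_, ⟨W, -, rfl⟩, _, rfl, rfl⟩, rfl⟩, rfl⟩, h⟩ := h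
  simp only [fromBlocks_multiply, fromBlocks_inj, mul_one, one_mul, mul_zero, zero_mul,
    add_zero, zero_add] at h
  obtain ⟨hA, hB, -, -⟩ := h
  have hBT : B = T + (1 + T * V) * W := by rw [← hB]; noncomm_ring
  rwa [hBT, hA, zero_mul, add_zero]

theorem fromBlocks_zero_neg_transpose_inv_mem_symplecticGroup {Q : Matrix n n R}
    (hQ : IsUnit Q) : fromBlocks 0 Q (-Qᵀ⁻¹) 0 ∈ symplecticGroup n R := by
  have hdet := (isUnit_iff_isUnit_det Q).1 hQ
  simp [SymplecticGroup.fromBlocks_mem_iff, transpose_nonsing_inv, nonsing_inv_mul Q hdet]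

theorem isSymm_of_isSymm_neg_transpose_inv {Q : Matrix n n R} (hQ : IsUnit Q)
    (h : (-Qᵀ⁻¹).IsSymm) : Q.IsSymm := by
  have hdet := isUnit_det_transpose Q ((isUnit_iff_isUnit_det Q).1 hQ)
  simpa [nonsing_inv_nonsing_inv _ hdet] using h.neg.inv.transpose

theorem fromBlocks_zero_neg_transpose_inv_notMem_triangularFactors_pow_four {Q : Matrix n n R}
    (hQ : IsUnit Q) (hsymm : ¬ Q.IsSymm) :
    fromBlocks 0 Q (-Qᵀ⁻¹) 0 ∉ triangularFactors n R ^ 4 := by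
  intro hmem
  rcases union_pow_subset_alternatingProducts _ _ 4 hmem with h | h
  · exact hsymm (isSymm_of_isSymm_neg_transpose_inv hQ
      (isSymm_of_mem_alternatingProducts_upper_lower h))
  · exact hsymm (isSymm_of_mem_alternatingProducts_lower_upper h)

variable (n R) in
theorem exists_isUnit_not_isSymm [Nontrivial n] [Nontrivial R] :
    ∃ Q : Matrix n n R, IsUnit Q ∧ ¬ Q.IsSymm := by
  obtain ⟨i, j, hij⟩ := exists_pair_ne n
  refine ⟨transvection i j 1, ?_, fun h => ?_⟩
  · rw [isUnit_iff_isUnit_det, det_transvection_of_ne _ _ hij]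
    exact isUnit_one
  · simpa [transvection, hij, hij.symm] using h.apply i j

theorem triangularFactors_pow_four_ssubset_symplecticGroup [Nontrivial n] [Nontrivial R] :
    triangularFactors n R ^ 4 ⊂ symplecticGroup n R := by
  obtain ⟨Q, hQ, hsymm⟩ := exists_isUnit_not_isSymm n R
  exact (Set.ssubset_iff_of_subset (triangularFactors_pow_subset_symplecticGroup 4)).2
    ⟨_, fromBlocks_zero_neg_transpose_inv_mem_symplecticGroup hQ,
      fromBlocks_zero_neg_transpose_inv_notMem_triangularFactors_pow_four hQ hsymm⟩

theorem unitTriangular_eq_triangularFactors (d : ℕ) (F : Type*) [Field F] :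
    unitTriangular d F = triangularFactors (Fin d) F := by
  ext H
  simp only [unitTriangular, Set.mem_ofPred_eq, and_or_left, exists_or, eq_comm (a := H)]
  rfl

theorem unitTriangularProducts_eq_triangularFactors_pow (d : ℕ) (F : Type*) [Field F] (k : ℕ) :
    unitTriangularProducts d F k = triangularFactors (Fin d) F ^ k := by
  rw [← unitTriangular_eq_triangularFactors]
  exact setOf_list_prod_eq_pow _ k

end Products

end SympFactor

theorem mainTheorem1 (F : Type*) [Field F] (d : ℕ) (hd : 2 ≤ d) :
    (∀ H ∈ symplecticGroup (Fin d) F,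
      ∃ δ : Fin d → F, (∀ i, δ i = 0 ∨ δ i = 1) ∧
      ∃ S T U V : Matrix (Fin d) (Fin d) F,
        S.IsSymm ∧ T.IsSymm ∧ U.IsSymm ∧ V.IsSymm ∧
        H = fromBlocks 1 (diagonal δ) 0 1 * fromBlocks 1 0 S 1 * fromBlocks 1 T 0 1 *
          fromBlocks 1 0 U 1 * fromBlocks 1 V 0 1) ∧
    (symplecticGroup (Fin d) F : Set (Matrix (Fin d ⊕ Fin d) (Fin d ⊕ Fin d) F)) =
      SympFactor.unitTriangularProducts d F 5 ∧
    SympFactor.unitTriangularProducts d F 4 ⊂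
      (symplecticGroup (Fin d) F : Set (Matrix (Fin d ⊕ Fin d) (Fin d ⊕ Fin d) F)) ∧
    (∀ Q : Matrix (Fin d) (Fin d) F, IsUnit Q → ¬ Q.IsSymm →
      fromBlocks 0 Q (-(Qᵀ)⁻¹) 0 ∈ symplecticGroup (Fin d) F ∧
      fromBlocks 0 Q (-(Qᵀ)⁻¹) 0 ∉ SympFactor.unitTriangularProducts d F 4) ∧
    IsLeast {n : ℕ | SympFactor.unitTriangularProducts d F n =
      (symplecticGroup (Fin d) F : Set (Matrix (Fin d ⊕ Fin d) (Fin d ⊕ Fin d) F))} 5 := by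
  have h5 := SympFactor.symplecticGroup_eq_triangularFactors_pow_five (n := Fin d) (F := F)
  have : Nontrivial (Fin d) := Fin.nontrivial_iff_two_le.2 hd
  have h4 := SympFactor.triangularFactors_pow_four_ssubset_symplecticGroup (n := Fin d) (R := F)
  simp only [SympFactor.unitTriangularProducts_eq_triangularFactors_pow]
  refine ⟨fun H hH => ?_, h5, h4, fun Q hQ hsymm => ⟨?_, ?_⟩, h5.symm, fun k hk => ?_⟩
  · exact SympFactor.exists_eq_diagonal_mul_four hH fun _ => Set.nontrivial_pair zero_ne_one
  · exact SympFactor.fromBlocks_zero_neg_transpose_inv_mem_symplecticGroup hQ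
  · exact SympFactor.fromBlocks_zero_neg_transpose_inv_notMem_triangularFactors_pow_four hQ hsymm
  · by_contra! hlt
    refine h4.not_subset (hk.symm.subset.trans ?_)
    exact Set.pow_subset_pow_right SympFactor.one_mem_triangularFactors (Nat.le_of_lt_succ hlt)
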